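/- Let $\mathbb F\subset\mathbb K$ be fields of characteristic zero and let $n\ge 1$ be an integer. A map $A\colon\mathbb F^n\to\mathbb K$ is called $n$-additive if it is additive in each variable. A function $f\colon\mathbb F\to\mathbb K$ is a generalized monomial of degree $n$ if $f(x)=A(x,\dots,x)$ for all $x\in\mathbb F$, for some symmetric $n$-additive $A\colon\mathbb F^n\to\mathbb K$. Derivations of order $m$ are defined recursively: the only derivation of order $0$ is the zero map, and for $m\ge1$ an additive $a\colon\mathbb F\to\mathbb K$ is a derivation of order $m$ if there is $B\colon\mathbb F\times\mathbb F\to\mathbb K$ which is a derivation of order $m-1$ in each variable such that $a(xy)-x\,a(y)-a(x)\,y=B(x,y)$ for all $x,y\in\mathbb F$. There are constants $\lambda_{n,1},\dots,\lambda_{n,n}\in\mathbb K$ (not depending on $\kappa$ and $f$) such that the following holds for every $\kappa\in\mathbb K$ and every generalized monomial $f\colon\mathbb F\to\mathbb K$ of degree $n$ satisfying $f(x^2)=\kappa\, x^n f(x)$ for all $x\in\mathbb F$. (i) If $\kappa\notin\{2^k : k=0,1,\dots,n\}$, then $f$ is identically zero. (ii) If $\kappa=1$, then $f(x)=f(1)\,x^n$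 for all $x\in\mathbb F$. (iii) If $\kappa=2$, then there is a derivation $a\colon\mathbb F\to\mathbb K$ of order $2n-1$ such that $f(x)=\sum_{j=1}^n\lambda_{n,j}\,x^{n-j}a(x^j)$ for all $x\in\mathbb F$. (iv) If $\kappa=2^n$, then there is a symmetric $n$-additive map $A_n\colon\mathbb F^n\to\mathbb K$ such that $f(x)=A_n(x,\dots,x)$ for all $x\in\mathbb F$ and, for all $x_1,\dots,x_{n+1}\in\mathbb F$, $$\sum_{\sigma\in\mathscr S_{n+1}}\Big\{A_n\big(x_{\sigma(1)}x_{\sigma(2)},x_{\sigma(3)},\dots,x_{\sigma(n+1)}\big)-x_{\sigma(1)}A_n\big(x_{\sigma(2)},x_{\sigma(3)},\dots,x_{\sigma(n+1)}\big)-x_{\sigma(2)}A_n\big(x_{\sigma(1)},x_{\sigma(3)},\dots,x_{\sigma(n+1)}\big)\Big\}=0 .$$ -/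

import Mathlib

/-- `A` is a symmetric `n`-additive map `F ^ n → K`: additivity in
each variable is `ℤ`-multilinearity, and the value does not change when the variables are
permuted. -/
def IsSymmetricMultiadditive {F K : Type*} [AddCommGroup F] [AddCommGroup K] {n : ℕ}
    (A : MultilinearMap ℤ (fun _ : Fin n => F) K) : Prop :=
  ∀ (σ : Equiv.Perm (Fin n)) (v : Fin n → F), A (fun i => v (σ i)) = A v

/-- `f` is a generalized monomial of degree `n`: the trace `x ↦ A (x, …, x)` of a symmetric
`n`-additive map `A`. -/
def IsGeneralizedMonomial {F K : Type*} [AddCommGroup F] [AddCommGroup K] (n : ℕ)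
    (f : F → K) : Prop :=
  ∃ A : MultilinearMap ℤ (fun _ : Fin n => F) K,
    IsSymmetricMultiadditive A ∧ ∀ x : F, f x = A (fun _ => x)

/-- Derivations of order `n` from a field `F` to an extension field `K`. The only derivation of
order `0` is the zero map. A derivation of order `n + 1` is an additive map `f` such that
`f (x * y) - x * f y - f x * y = B x y` for some `B` which is a derivation of order `n`
in each variable. -/
def IsDerivationOfOrder {F K : Type*} [Field F] [Field K] [Algebra F K] :
    ℕ → (F → K) → Prop
  | 0, f => ∀ x : F, f x = 0
  | n + 1, f =>
    (∀ x y : F, f (x + y) = f x + f y) ∧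
      ∃ B : F → F → K,
        (∀ y : F, IsDerivationOfOrder n (fun x => B x y)) ∧
        (∀ x : F, IsDerivationOfOrder n (fun y => B x y)) ∧
        ∀ x y : F, f (x * y) - algebraMap F K x * f y - f x * algebraMap F K y = B x y

/-- The summand of the symmetrized Leibniz identity, at `y = (y₁, …, yₙ₊₁)`, indexed from `0`:
`A (y₁ y₂, y₃, …, yₙ₊₁) - y₁ A (y₂, y₃, …, yₙ₊₁) - y₂ A (y₁, y₃, …, yₙ₊₁)`. -/
def leibnizDefect {F K : Type*} [Field F] [Field K] [Algebra F K] {n : ℕ}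
    (A : MultilinearMap ℤ (fun _ : Fin n => F) K) (y : Fin (n + 1) → F) : K :=
  A (fun i => if (i : ℕ) = 0 then y 0 * y 1 else y i.succ)
    - algebraMap F K (y 0) * A (fun i => y i.succ)
    - algebraMap F K (y 1) * A (fun i => if (i : ℕ) = 0 then y 0 else y i.succ)

/-! Substitute `1 + t * r`, with `t` an integer, and compare coefficients in `t`. Let `T_k(r)` be
the coefficient of `t ^ k` in `f (1 + t r)`; it is homogeneous of degree `k` in `r`, and `T_n = f`.
Since `(1 + t r)² = 1 + t (2 r + t r²)`, the first `T_k` not known to vanish satisfies `2 ^ k T_k =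
κ T_k`, so only `κ = 2 ^ k` lets it survive (`oneAddCoeff_eq_zero`). This gives (i). For (ii),
subtracting `f(1) x ^ n` makes `T_0` vanish.

If `κ = 2 ^ n`, then `T_k = 0` for `k < n`, so `f (1 + v) = f v`. The equation at `1 + t x` then
gives, to first order, `A (x², x, …, x) = 2 x f(x)`; polarization yields the symmetrized identity.

If `κ = 2`, put `a(z) = DA(1)(z)`. Differentiating the equation shows that `DA(y)(y z) - a(z) y ^ n
- n z f(y)` solves the case `κ = 1` and vanishes at `y = 1`, hence is zero. Along `1 + t x` this
becomes a polynomial identity. Its coefficient of degree `n + 1` gives `(mulDifference K x ^ (n +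
1)) a = 0`, so `a` has order `n ≤ 2 n - 1`; the lower coefficients give a recursion recovering `f`
from the values `a (x ^ j)`. -/

open Polynomial

/-! ### Multiadditive maps along integer lines -/

/-- The polynomial `t ↦ A (U + t V)` attached to a multiadditive map `A`. -/
noncomputable def curvePolynomial {F K ι : Type*} [AddCommGroup F] [CommRing K] [Fintype ι]
    [DecidableEq ι] (A : MultilinearMap ℤ (fun _ : ι => F) K) (U V : ι → F) : K[X] :=
  ∑ s : Finset ι, monomial s.card (A (s.piecewise V U))

section curvePolynomial

variable {F K ι : Type*} [AddCommGroup F] [CommRing K] [DecidableEq ι]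
  (A : MultilinearMap ℤ (fun _ : ι => F) K)

theorem map_piecewise_intCast_smul (t : ℤ) (U V : ι → F) (s : Finset ι) :
    A (s.piecewise (t • V) U) = (t : K) ^ s.card * A (s.piecewise V U) := by
  have h := A.map_piecewise_smul (fun _ => t) (s.piecewise V U) s
  have e : s.piecewise (fun i => t • s.piecewise V U i) (s.piecewise V U)
      = s.piecewise (t • V) U := by
    ext i
    by_cases hi : i ∈ s <;> simp [hi]
  rw [e] at h
  rw [h]
  simp

variable [Fintype ι]

theorem eval_curvePolynomial (U V : ι → F) (t : ℤ) :
    (curvePolynomial A U V).eval (t : K) = A (U + t • V) := by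
  rw [add_comm U, A.map_add_univ, curvePolynomial, eval_finsetSum]
  refine Finset.sum_congr rfl fun s _ => ?_
  rw [map_piecewise_intCast_smul, eval_monomial, mul_comm]

theorem natDegree_curvePolynomial_le (U V : ι → F) :
    (curvePolynomial A U V).natDegree ≤ Fintype.card ι := by
  refine natDegree_sum_le_of_forall_le _ _ fun s _ => ?_
  exact (natDegree_monomial_le _).trans (Finset.card_le_univ s)

theorem coeff_curvePolynomial (U V : ι → F) (k : ℕ) :
    (curvePolynomial A U V).coeff k =
      ∑ s : Finset ι with s.card = k, A (s.piecewise V U) := by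
  rw [curvePolynomial, finsetSum_coeff, Finset.sum_filter]
  exact Finset.sum_congr rfl fun s _ => by rw [coeff_monomial]

theorem coeff_curvePolynomial_card (U V : ι → F) :
    (curvePolynomial A U V).coeff (Fintype.card ι) = A V := by
  rw [coeff_curvePolynomial, Finset.sum_eq_single Finset.univ]
  · simp
  · intro s hs hne
    exact absurd (Finset.card_eq_iff_eq_univ s |>.mp (Finset.mem_filter.mp hs).2) hne
  · simp [Finset.card_univ]

theorem coeff_zero_curvePolynomial (U V : ι → F) :
    (curvePolynomial A U V).coeff 0 = A U := by
  have h := eval_curvePolynomial A U V 0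
  simpa [coeff_zero_eq_eval_zero] using h

theorem coeff_one_curvePolynomial (U V : ι → F) :
    (curvePolynomial A U V).coeff 1 = A.linearDeriv U V := by
  rw [coeff_curvePolynomial, MultilinearMap.linearDeriv_apply]
  rw [show (Finset.univ.filter fun s : Finset ι => s.card = 1)
      = Finset.univ.map ⟨fun i => ({i} : Finset ι), Finset.singleton_injective⟩ by
    ext s
    simp [Finset.card_eq_one, eq_comm]]
  simp [Finset.piecewise_singleton]

theorem coeff_curvePolynomial_intCast_smul (U V : ι → F) (t : ℤ) (k : ℕ) :
    (curvePolynomial A U (t • V)).coeff k = (t : K) ^ k * (curvePolynomial A U V).coeff k := by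
  rw [coeff_curvePolynomial, coeff_curvePolynomial, Finset.mul_sum]
  refine Finset.sum_congr rfl fun s hs => ?_
  rw [map_piecewise_intCast_smul, (Finset.mem_filter.mp hs).2]

/-- The coefficients of `curvePolynomial A U V` depend polynomially on the direction `V`. -/
theorem exists_eval_eq_coeff_curvePolynomial (U V W : ι → F) (k : ℕ) :
    ∃ Q : K[X], ∀ t : ℤ, Q.eval (t : K) = (curvePolynomial A U (V + t • W)).coeff k := by
  refine ⟨∑ s : Finset ι with s.card = k,
    curvePolynomial A (s.piecewise V U) (s.piecewise W 0), fun t => ?_⟩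
  rw [coeff_curvePolynomial, eval_finsetSum]
  refine Finset.sum_congr rfl fun s _ => ?_
  rw [eval_curvePolynomial]
  congr 1
  ext i
  by_cases hi : i ∈ s <;> simp [hi]

theorem map_add_eq_sum_coeff_curvePolynomial (U V : ι → F) :
    A (U + V) =
      ∑ k ∈ Finset.range (Fintype.card ι + 1), (curvePolynomial A U V).coeff k := by
  have h := eval_curvePolynomial A U V 1
  rw [eval_eq_sum_range' (Nat.lt_succ_of_le (natDegree_curvePolynomial_le A U V))] at h
  simpa using h.symm

end curvePolynomial

/-- Additivity only allows integer parameters; in characteristic zero these are infinitely many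
points, enough to compare coefficients. -/
theorem Polynomial.eq_of_forall_eval_intCast {K : Type*} [CommRing K] [IsDomain K] [CharZero K]
    {p q : K[X]} (h : ∀ t : ℤ, p.eval (t : K) = q.eval (t : K)) : p = q := by
  refine eq_of_infinite_eval_eq p q ((Set.infinite_range_of_injective
    (Int.cast_injective (α := K))).mono ?_)
  rintro _ ⟨t, rfl⟩
  exact h t

/-! ### Coefficient comparison at 1: the generic case and `κ = 1` -/

section PowerFunctional

variable {F K : Type*} [Field F] [Field K] {n : ℕ}

/-- The coefficient of `t ^ k` in `A (1 + t r, …, 1 + t r)`. -/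
noncomputable def oneAddCoeff (A : MultilinearMap ℤ (fun _ : Fin n => F) K) (k : ℕ) (r : F) : K :=
  (curvePolynomial A (fun _ => 1) (fun _ => r)).coeff k

theorem oneAddCoeff_self (A : MultilinearMap ℤ (fun _ : Fin n => F) K) (r : F) :
    oneAddCoeff A n r = A (fun _ => r) := by
  have := coeff_curvePolynomial_card A (fun _ => (1 : F)) (fun _ => r)
  rwa [Fintype.card_fin] at this

theorem oneAddCoeff_zero (A : MultilinearMap ℤ (fun _ : Fin n => F) K) (r : F) :
    oneAddCoeff A 0 r = A (fun _ => 1) :=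
  coeff_zero_curvePolynomial A _ _

variable [Algebra F K]

/-- With all lower coefficients zero, the `t ^ k` terms at `1 + t r` are `2 ^ k T_k(r)` on the left,
by homogeneity, and `κ T_k(r)` on the right. -/
theorem oneAddCoeff_eq_zero [CharZero K] (A : MultilinearMap ℤ (fun _ : Fin n => F) K) (κ : K)
    (h : ∀ x : F, A (fun _ => x ^ 2) = κ * algebraMap F K x ^ n * A (fun _ => x)) (k : ℕ)
    (hlt : ∀ j < k, ∀ r, oneAddCoeff A j r = 0) (hκ : κ ≠ 2 ^ k) (r : F) :
    oneAddCoeff A k r = 0 := by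
  by_cases hkn : n < k
  · exact coeff_eq_zero_of_natDegree_lt
      ((natDegree_curvePolynomial_le A _ _).trans_lt (by simpa using hkn))
  -- `Q d` interpolates `t ↦ T_d(2 r + t r²)`, as `(1 + t r)² = 1 + t (2 r + t r²)`.
  choose Q hQ using exists_eval_eq_coeff_curvePolynomial A (fun _ => (1 : F))
    (fun _ => 2 * r) (fun _ => r ^ 2)
  set T := curvePolynomial A (fun _ => 1) (fun _ => r) with hT
  set W : K[X] := (1 + C (algebraMap F K r) * X) ^ n with hW
  have key : ∑ d ∈ Finset.range (n + 1), X ^ d * Q d = C κ * W * T := by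
    refine eq_of_forall_eval_intCast fun t => ?_
    have h1 := h (1 + t * r)
    have e1 : (fun _ : Fin n => (1 + t * r) ^ 2)
        = (fun _ => 1) + t • ((fun _ => 2 * r) + t • (fun _ => r ^ 2) : Fin n → F) := by
      ext i
      change (1 + t * r) ^ 2 = 1 + t • (2 * r + t • r ^ 2)
      rw [zsmul_eq_mul, zsmul_eq_mul]
      ring
    have e2 : (fun _ : Fin n => (1 + t * r))
        = (fun _ => 1) + t • (fun _ => r : Fin n → F) := by
      ext i
      simp
    rw [e1, e2, ← eval_curvePolynomial, ← eval_curvePolynomial, ← hT,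
      eval_eq_sum_range' (n := n + 1) (Nat.lt_succ_of_le
        ((natDegree_curvePolynomial_le A _ _).trans_eq (Fintype.card_fin n)))] at h1
    rw [eval_finsetSum]
    simp only [eval_mul, eval_pow, eval_X, hQ, eval_C, hW, eval_add, eval_one]
    simp only [map_add, map_one, map_mul, map_intCast] at h1
    rw [mul_comm _ (t : K), ← h1]
    exact Finset.sum_congr rfl fun d _ => mul_comm _ _
  have hQ0 : ∀ d < k, Q d = 0 := fun d hd => eq_of_forall_eval_intCast fun t => by
    rw [hQ, eval_zero]
    have := hlt d hd (2 * r + t * r ^ 2)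
    rw [oneAddCoeff] at this
    rw [← this]
    congr 2
    ext i
    simp
  have hQk : (Q k).coeff 0 = 2 ^ k * oneAddCoeff A k r := by
    have h0 := hQ k 0
    rw [coeff_zero_eq_eval_zero]
    have h2 := coeff_curvePolynomial_intCast_smul A (fun _ => (1 : F)) (fun _ => r) 2 k
    rw [oneAddCoeff]
    simp only [Int.cast_ofNat, Int.cast_zero, zero_smul, add_zero] at h0 h2
    rw [h0, ← h2]
    congr 2
    ext i
    simp
  have hl : (∑ d ∈ Finset.range (n + 1), X ^ d * Q d).coeff k = (Q k).coeff 0 := by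
    rw [finsetSum_coeff, Finset.sum_eq_single k]
    · simp [coeff_X_pow_mul']
    · intro d _ hdk
      rcases lt_or_gt_of_ne hdk with hd | hd
      · simp [hQ0 d hd]
      · rw [coeff_X_pow_mul', if_neg (by omega)]
    · intro hk
      exact absurd (Finset.mem_range.mpr (by omega)) hk
  have hr : (C κ * W * T).coeff k = κ * oneAddCoeff A k r := by
    rw [mul_assoc, coeff_C_mul, coeff_mul, Finset.sum_eq_single (0, k)]
    · simp [hW, coeff_zero_eq_eval_zero, oneAddCoeff, hT]
    · rintro ⟨i, j⟩ hij hne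
      have hij' := Finset.HasAntidiagonal.mem_antidiagonal.mp hij
      have : j < k := by
        rcases Nat.eq_zero_or_pos i with rfl | hi
        · simp_all
        · simp only at hij'
          omega
      have h0 := hlt j this r
      rw [oneAddCoeff] at h0
      simp [hT, h0]
    · intro hk
      simp at hk
  have h3 : (2 ^ k - κ) * oneAddCoeff A k r = 0 := by
    rw [sub_mul, ← hQk, ← hr, ← key, hl, sub_self]
  exact (mul_eq_zero.mp h3).resolve_left (sub_ne_zero.mpr hκ.symm)

/-- If the exceptional coefficients vanish then all do. -/
theorem oneAddCoeff_eq_zero_of_exceptional [CharZero K] (A : MultilinearMap ℤ (fun _ : Fin n => F) K) (κ : K)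
    (h : ∀ x : F, A (fun _ => x ^ 2) = κ * algebraMap F K x ^ n * A (fun _ => x)) (m : ℕ)
    (hm : ∀ k ≤ m, κ = 2 ^ k → ∀ r, oneAddCoeff A k r = 0) :
    ∀ k ≤ m, ∀ r, oneAddCoeff A k r = 0 := by
  intro k
  induction k using Nat.strong_induction_on with
  | _ k ih =>
    intro hk r
    by_cases hκ : κ = 2 ^ k
    · exact hm k hk hκ r
    · exact oneAddCoeff_eq_zero A κ h k (fun j hj => ih j hj (by omega)) hκ r

theorem trace_eq_zero_of_ne_two_pow [CharZero K] (A : MultilinearMap ℤ (fun _ : Fin n => F) K) (κ : K)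
    (h : ∀ x : F, A (fun _ => x ^ 2) = κ * algebraMap F K x ^ n * A (fun _ => x))
    (hκ : ∀ k ≤ n, κ ≠ 2 ^ k) (x : F) : A (fun _ => x) = 0 := by
  rw [← oneAddCoeff_self]
  exact oneAddCoeff_eq_zero_of_exceptional A κ h n (fun k hk e => absurd e (hκ k hk)) n le_rfl x

/-- Only `k = 0` is exceptional for `κ = 1`, and that coefficient is the value at 1. -/
theorem trace_eq_zero_of_map_one [CharZero K] (A : MultilinearMap ℤ (fun _ : Fin n => F) K)
    (h : ∀ x : F, A (fun _ => x ^ 2) = algebraMap F K x ^ n * A (fun _ => x))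
    (h1 : A (fun _ => 1) = 0) (x : F) : A (fun _ => x) = 0 := by
  rw [← oneAddCoeff_self]
  refine oneAddCoeff_eq_zero_of_exceptional A 1 (by simpa using h) n (fun k hk e r => ?_) n le_rfl x
  have hk0 : k = 0 := by
    by_contra hk0
    have h2 : (1 : ℕ) = 2 ^ k := by exact_mod_cast e
    exact (Nat.one_lt_two_pow hk0).ne h2
  rw [hk0, oneAddCoeff_zero, h1]

/-- The product of the variables, as a multiadditive map. -/
noncomputable def algebraMapProd (F K : Type*) [Field F] [Field K] [Algebra F K] (n : ℕ) :
    MultilinearMap ℤ (fun _ : Fin n => F) K :=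
  ((algebraMap F K).toIntAlgHom.toLinearMap).compMultilinearMap
    (MultilinearMap.mkPiAlgebra ℤ (Fin n) F)

theorem algebraMapProd_const (x : F) :
    algebraMapProd F K n (fun _ => x) = algebraMap F K x ^ n := by
  simp [algebraMapProd]

theorem trace_eq_mul_pow [CharZero K] (A : MultilinearMap ℤ (fun _ : Fin n => F) K)
    (h : ∀ x : F, A (fun _ => x ^ 2) = algebraMap F K x ^ n * A (fun _ => x)) (x : F) :
    A (fun _ => x) = A (fun _ => 1) * algebraMap F K x ^ n := by
  have := trace_eq_zero_of_map_one (A - A (fun _ => 1) • algebraMapProd F K n) (fun y => ?_) ?_ x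
  · simpa [algebraMapProd_const, sub_eq_zero] using this
  · simp only [sub_apply, smul_apply, algebraMapProd_const, h,
      map_pow, smul_eq_mul]
    ring
  · simp [algebraMapProd_const]

end PowerFunctional

/-! ### Polarization and the symmetrized Leibniz identity -/

/-- A map that is additive in each variable is `ℤ`-multilinear. -/
def MultilinearMap.ofUpdateAdd {M N ι : Type*} [AddCommGroup M] [AddCommGroup N] [DecidableEq ι]
    (f : (ι → M) → N) (h : ∀ (y : ι → M) (j : ι) (u v : M), f (Function.update y j (u + v)) =
      f (Function.update y j u) + f (Function.update y j v)) :
    MultilinearMap ℤ (fun _ : ι => M) N :=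
  MultilinearMap.mk' f h fun y j c u =>
    (AddMonoidHom.mk' (fun v => f (Function.update y j v)) (h y j)).map_zsmul c u

/-- If `r` misses `j`, toggling `j` in `s` is a sign-reversing involution; if `r` is bijective, only
`s = univ` contributes. -/
theorem Finset.sum_neg_one_pow_card_filter_forall_mem {ι : Type*} [Fintype ι] [DecidableEq ι]
    (r : ι → ι) :
    ∑ s : Finset ι, (if ∀ i, r i ∈ s then (-1 : ℤ) ^ s.card else 0) =
      if Function.Bijective r then (-1) ^ Fintype.card ι else 0 := by
  split_ifs with hr
  · rw [Finset.sum_eq_single Finset.univ]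
    · simp [Finset.card_univ]
    · intro s _ hs
      refine if_neg fun h => hs (Finset.eq_univ_iff_forall.mpr fun j => ?_)
      obtain ⟨i, rfl⟩ := hr.2 j
      exact h i
    · simp
  · obtain ⟨j, hj⟩ : ∃ j, ∀ i, r i ≠ j := by
      by_contra! h
      exact hr (Finite.surjective_iff_bijective.mp h)
    refine Finset.sum_involution (fun s _ => symmDiff s {j}) ?_ ?_ ?_ ?_
    · intro s _
      have hmem : (∀ i, r i ∈ symmDiff s {j}) ↔ ∀ i, r i ∈ s :=
        forall_congr' fun i => by simp [Finset.mem_symmDiff, hj i]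
      simp only [hmem]
      split_ifs
      · by_cases hs : j ∈ s
        · have e : symmDiff s {j} = s.erase j := by
            ext x
            by_cases hx : x = j <;> simp [Finset.mem_symmDiff, hx, hs]
          rw [e, ← Finset.card_erase_add_one hs]
          ring
        · have e : symmDiff s {j} = insert j s := by
            ext x
            by_cases hx : x = j <;> simp [Finset.mem_symmDiff, hx, hs]
          rw [e, Finset.card_insert_of_notMem hs]
          ring
      · simp
    · intro s _ _ h
      have := congrArg (j ∈ ·) h
      simp [Finset.mem_symmDiff] at this
    · simp
    · intro s _
      simp

/-- Polarization: a multiadditive map that vanishes on the diagonal has zero symmetrization. -/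
theorem MultilinearMap.sum_perm_eq_zero_of_diagonal {M N ι : Type*} [AddCommGroup M]
    [AddCommGroup N] [Fintype ι] [DecidableEq ι] (B : MultilinearMap ℤ (fun _ : ι => M) N)
    (h : ∀ x : M, B (fun _ => x) = 0) (x : ι → M) :
    ∑ σ : Equiv.Perm ι, B (fun i => x (σ i)) = 0 := by
  have h1 : ∑ s : Finset ι, (-1 : ℤ) ^ s.card • B (fun _ => ∑ j ∈ s, x j) = 0 :=
    Finset.sum_eq_zero fun s _ => by rw [h, smul_zero]
  have h2 : ∀ s : Finset ι, (-1 : ℤ) ^ s.card • B (fun _ => ∑ j ∈ s, x j) =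
      ∑ r : ι → ι, (if ∀ i, r i ∈ s then (-1 : ℤ) ^ s.card else 0) • B (fun i => x (r i)) := by
    intro s
    rw [B.map_sum_finset (fun _ j => x j) (fun _ => s), Finset.smul_sum]
    simp only [ite_smul, zero_smul]
    rw [← Finset.sum_filter]
    refine Finset.sum_congr ?_ fun _ _ => rfl
    ext r
    simp [Fintype.mem_piFinset]
  simp only [h2] at h1
  rw [Finset.sum_comm] at h1
  simp only [← Finset.sum_smul, Finset.sum_neg_one_pow_card_filter_forall_mem] at h1
  simp only [ite_smul, zero_smul] at h1
  rw [← Finset.sum_filter, ← Finset.smul_sum] at h1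
  have h3 : ∑ r : ι → ι with Function.Bijective r, B (fun i => x (r i)) = 0 := by
    have := congrArg (fun y => (-1 : ℤ) ^ Fintype.card ι • y) h1
    rwa [smul_zero, smul_smul, ← mul_pow, neg_one_mul, neg_neg, one_pow, one_smul] at this
  rw [← h3]
  refine Finset.sum_bij (fun σ _ => σ) ?_ ?_ ?_ ?_
  · intro σ _
    simp
  · intro σ _ τ _ hst
    exact DFunLike.coe_injective hst
  · intro r hr
    exact ⟨Equiv.ofBijective r (Finset.mem_filter.mp hr).2, Finset.mem_univ _, rfl⟩
  · intro σ _
    rfl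

section

variable {F K : Type*} [Field F] [Field K] [Algebra F K] {n : ℕ}

theorem leibnizDefect_eq_curryLeft (A : MultilinearMap ℤ (fun _ : Fin (n + 1) => F) K)
    (y : Fin (n + 2) → F) :
    leibnizDefect A y = A.curryLeft (y 0 * y 1) (fun i => y i.succ.succ)
      - algebraMap F K (y 0) * A.curryLeft (y 1) (fun i => y i.succ.succ)
      - algebraMap F K (y 1) * A.curryLeft (y 0) (fun i => y i.succ.succ) := by
  simp only [leibnizDefect, MultilinearMap.curryLeft_apply]
  have e : ∀ u : F, (fun i : Fin (n + 1) => if (i : ℕ) = 0 then u else y i.succ) =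
      Fin.cons u fun i => y i.succ.succ := by
    intro u
    ext i
    cases i using Fin.cases <;> simp
  have e' : (fun i : Fin (n + 1) => y i.succ) = Fin.cons (y 1) fun i => y i.succ.succ := by
    ext i
    cases i using Fin.cases <;> simp
  rw [e, e, e']

/-- The Leibniz defect as a multiadditive map. -/
noncomputable def leibnizDefectMap (A : MultilinearMap ℤ (fun _ : Fin (n + 1) => F) K) :
    MultilinearMap ℤ (fun _ : Fin (n + 2) => F) K :=
  MultilinearMap.ofUpdateAdd (fun y => leibnizDefect A y)
    (by
      intro y j u v
      simp only [leibnizDefect_eq_curryLeft]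
      cases j using Fin.cases with
      | zero =>
        simp [add_mul]
        ring
      | succ j =>
        cases j using Fin.cases with
        | zero =>
          simp [Fin.succ_succ_ne_one, mul_add, add_mul]
          ring
        | succ k =>
          have e : ∀ w : F, (fun i : Fin n => Function.update y k.succ.succ w i.succ.succ) =
              Function.update (fun i => y i.succ.succ) k w := by
            intro w
            ext i
            by_cases hi : i = k
            · simp [hi]
            · simp [hi]
          simp only [e, MultilinearMap.map_update_add]
          simp [(Fin.succ_succ_ne_one _).symm, (Fin.succ_ne_zero _).symm]
          ring)

/-- On the diagonal the defect is `A (x², x, …, x) - 2 x A (x, …, x)`, so polarization applies. -/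
theorem sum_perm_leibnizDefect_eq_zero (A : MultilinearMap ℤ (fun _ : Fin (n + 1) => F) K)
    (h : ∀ x : F, A (Function.update (fun _ => x) 0 (x * x)) =
      2 * algebraMap F K x * A (fun _ => x)) (x : Fin (n + 2) → F) :
    ∑ σ : Equiv.Perm (Fin (n + 2)), leibnizDefect A (fun i => x (σ i)) = 0 := by
  refine (leibnizDefectMap A).sum_perm_eq_zero_of_diagonal (fun y => ?_) x
  change leibnizDefect A (fun _ => y) = 0
  have e : (fun i : Fin (n + 1) => if (i : ℕ) = 0 then y * y else y) =
      Function.update (fun _ => y) 0 (y * y) := by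
    ext i
    cases i using Fin.cases <;> simp
  simp only [leibnizDefect, e, h, ite_self]
  ring

end

/-! ### First-order consequences for `κ = 2 ^ n` and `κ = 2` -/

theorem linearDeriv_const_of_isSymmetric {F K : Type*} [Field F] [Field K] {n : ℕ}
    {A : MultilinearMap ℤ (fun _ : Fin n => F) K}
    (hA : IsSymmetricMultiadditive A) (i : Fin n) (u v : F) :
    A.linearDeriv (fun _ => u) (fun _ => v) = n * A (Function.update (fun _ => u) i v) := by
  rw [MultilinearMap.linearDeriv_apply]
  have : ∀ j, A (Function.update (fun _ => u) j v) = A (Function.update (fun _ => u) i v) := by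
    intro j
    rw [← hA (Equiv.swap i j)]
    congr 1
    ext k
    by_cases hk : k = i
    · simp [hk]
    · have : Equiv.swap i j k ≠ j := fun h => hk
        ((Equiv.swap i j).injective (h.trans (Equiv.swap_apply_left i j).symm))
      simp [this, hk]
  simp [this]


theorem Polynomial.coeff_one_eq_eval_derivative {R : Type*} [CommSemiring R] (p : R[X]) :
    p.coeff 1 = p.derivative.eval 0 := by
  rw [← coeff_zero_eq_eval_zero, coeff_derivative]
  simp

theorem Polynomial.coeff_one_add_C_mul_X_pow {R : Type*} [CommRing R] (c : R) (m k : ℕ) :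
    ((1 + C c * X) ^ m : R[X]).coeff k = m.choose k * c ^ k := by
  have h : ((1 + C c * X) ^ m : R[X]) = ((1 + X) ^ m : R[X]).comp (C c * X) := by simp
  rw [h, comp_C_mul_X_coeff, coeff_one_add_X_pow]

theorem exists_eval_eq_map_quadratic_curve {F K ι : Type*} [AddCommGroup F] [Field K] [CharZero K]
    [Fintype ι] [DecidableEq ι] (A : MultilinearMap ℤ (fun _ : ι => F) K) (U V W : ι → F) :
    ∃ Q : K[X], (∀ t : ℤ, Q.eval (t : K) = A (U + t • (V + t • W))) ∧
      Q.coeff 1 = A.linearDeriv U V := by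
  choose Q hQ using exists_eval_eq_coeff_curvePolynomial A U V W
  refine ⟨∑ d ∈ Finset.range (Fintype.card ι + 2), X ^ d * Q d, fun t => ?_, ?_⟩
  · rw [← eval_curvePolynomial, eval_eq_sum_range' (n := Fintype.card ι + 2)
      ((natDegree_curvePolynomial_le A _ _).trans_lt (by omega)), eval_finsetSum]
    refine Finset.sum_congr rfl fun d _ => ?_
    rw [eval_mul, eval_pow, eval_X, hQ, mul_comm]
  · have h0 : Q 0 = C (A U) := eq_of_forall_eval_intCast fun t => by
      rw [hQ, coeff_zero_curvePolynomial, eval_C]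
    have h1 : (Q 1).coeff 0 = A.linearDeriv U V := by
      have := hQ 1 0
      rw [coeff_zero_eq_eval_zero]
      simpa [coeff_one_curvePolynomial] using this
    rw [finsetSum_coeff, Finset.sum_eq_single 1]
    · simpa using h1
    · intro d _ hd
      rcases Nat.eq_zero_or_pos d with rfl | hd0
      · simp [h0]
      · rw [coeff_X_pow_mul', if_neg (by omega)]
    · simp

section PowerFunctional

variable {F K : Type*} [Field F] [Field K] [CharZero K] [Algebra F K] {n : ℕ}

theorem map_update_sq_eq_of_two_pow {A : MultilinearMap ℤ (fun _ : Fin n => F) K}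
    (hA : IsSymmetricMultiadditive A)
    (h : ∀ x : F, A (fun _ => x ^ 2) = 2 ^ n * algebraMap F K x ^ n * A (fun _ => x))
    (i : Fin n) (x : F) :
    A (Function.update (fun _ => x) i (x * x)) = 2 * algebraMap F K x * A (fun _ => x) := by
  have hn : n ≠ 0 := by
    rintro rfl
    exact i.elim0
  -- Stopping at `n - 1` avoids the sole exceptional index `n`.
  have h0 : ∀ k < n, ∀ r, oneAddCoeff A k r = 0 := fun k hk =>
    oneAddCoeff_eq_zero_of_exceptional A (2 ^ n) h (n - 1) (fun j hj e => by
      have h2 : (2 : ℕ) ^ n = 2 ^ j := by exact_mod_cast e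
      have := Nat.pow_right_injective le_rfl h2
      omega) k (by omega)
  have hone : ∀ v : F, A (fun _ => 1 + v) = A (fun _ => v) := by
    intro v
    have := map_add_eq_sum_coeff_curvePolynomial A (fun _ => 1) (fun _ => v)
    rw [Fintype.card_fin, Finset.sum_range_succ, Finset.sum_eq_zero, zero_add] at this
    · exact this.trans (oneAddCoeff_self A v)
    · exact fun k hk => h0 k (Finset.mem_range.mp hk) v
  have hsmul : ∀ (t : ℤ) (V : Fin n → F), A (t • V) = (t : K) ^ n * A V := by
    intro t V
    have := A.map_smul_univ (fun _ => t) V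
    simp only [Finset.prod_const, Finset.card_univ, Fintype.card_fin, zsmul_eq_mul] at this
    rw [Int.cast_pow] at this
    rw [← this]
    congr 1
    ext j
    simp
  -- By homogeneity both sides of the equation at `1 + t x` carry `t ^ n`; after cancelling it, the
  -- linear coefficient is the claim up to the factors `n` and `2 ^ n`.
  have key : X ^ n * curvePolynomial A (fun _ => 2 * x) (fun _ => x ^ 2) =
      X ^ n * (C (2 ^ n * A (fun _ => x)) * (1 + C (algebraMap F K x) * X) ^ n) := by
    refine eq_of_forall_eval_intCast fun t => ?_
    simp only [eval_mul, eval_pow, eval_X, eval_C, eval_add, eval_one]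
    have h1 := h (1 + t * x)
    have e1 : (fun _ : Fin n => (1 + t * x) ^ 2) =
        fun _ => 1 + (t * (2 * x + t * x ^ 2)) := by
      ext j
      ring
    have e2 : (fun _ : Fin n => t * (2 * x + t * x ^ 2)) =
        t • ((fun _ => 2 * x) + t • (fun _ => x ^ 2) : Fin n → F) := by
      ext j
      simp [mul_add]
    have e3 : (fun _ : Fin n => t * x) = t • (fun _ => x : Fin n → F) := by
      ext j
      simp
    rw [e1, hone, hone, e2, e3, hsmul, hsmul, ← eval_curvePolynomial] at h1
    rw [h1]
    simp
    ring
  have h1 := congrArg (fun p => p.coeff 1) (mul_left_cancel₀ (pow_ne_zero n X_ne_zero) key)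
  simp only [coeff_one_curvePolynomial, coeff_C_mul, coeff_one_add_C_mul_X_pow,
    linearDeriv_const_of_isSymmetric hA i] at h1
  have h2 : 2 * A (Function.update (fun _ => 2 * x) i (x ^ 2)) =
      2 ^ n * A (Function.update (fun _ => x) i (x * x)) := by
    have e : (2 : ℤ) • Function.update (fun _ : Fin n => x) i (x * x) =
        Function.update (fun _ => 2 * x) i ((2 : ℤ) • x ^ 2) := by
      ext j
      by_cases hj : j = i
      · subst hj
        simp [sq]
      · simp [hj]
    have h3 := hsmul 2 (Function.update (fun _ : Fin n => x) i (x * x))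
    rw [e, A.map_update_smul] at h3
    simpa using h3
  have hnK : (n : K) ≠ 0 := Nat.cast_ne_zero.mpr hn
  have h3 : A (Function.update (fun _ => 2 * x) i (x ^ 2)) =
      2 ^ n * algebraMap F K x * A (fun _ => x) := by
    refine mul_left_cancel₀ hnK (h1.trans ?_)
    simp
    ring
  refine mul_left_cancel₀ (pow_ne_zero n (two_ne_zero (α := K))) ?_
  rw [← h2, h3]
  ring

/-- The differentiated functional equation. -/
theorem linearDeriv_sq_mul (A : MultilinearMap ℤ (fun _ : Fin n => F) K)
    (h : ∀ x : F, A (fun _ => x ^ 2) = 2 * algebraMap F K x ^ n * A (fun _ => x)) (x z : F) :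
    A.linearDeriv (fun _ => x ^ 2) (fun _ => x * z) =
      algebraMap F K x ^ n * A.linearDeriv (fun _ => x) (fun _ => z)
        + n * algebraMap F K x ^ (n - 1) * algebraMap F K z * A (fun _ => x) := by
  obtain ⟨Q, hQ, hQ1⟩ := exists_eval_eq_map_quadratic_curve A (fun _ => x ^ 2)
    (fun _ => 2 * (x * z)) (fun _ => z ^ 2)
  have key : Q = C 2 * ((C (algebraMap F K x) + C (algebraMap F K z) * X) ^ n *
      curvePolynomial A (fun _ => x) (fun _ => z)) := by
    refine eq_of_forall_eval_intCast fun t => ?_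
    have h1 := h (x + t * z)
    have e1 : (fun _ : Fin n => (x + t * z) ^ 2) =
        (fun _ => x ^ 2) + t • ((fun _ => 2 * (x * z)) + t • (fun _ => z ^ 2) : Fin n → F) := by
      ext j
      change (x + t * z) ^ 2 = x ^ 2 + t • (2 * (x * z) + t • z ^ 2)
      rw [zsmul_eq_mul, zsmul_eq_mul]
      ring
    have e2 : (fun _ : Fin n => x + t * z) = (fun _ => x) + t • (fun _ => z : Fin n → F) := by
      ext j
      simp
    rw [e1, e2, ← hQ, ← eval_curvePolynomial] at h1
    rw [h1]
    simp
    ring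
  have e : (fun _ : Fin n => 2 * (x * z)) = (2 : ℤ) • (fun _ => x * z : Fin n → F) := by
    ext j
    simp
  rw [key, e, map_smul, coeff_C_mul, mul_coeff_one, coeff_one_curvePolynomial,
    coeff_zero_curvePolynomial, coeff_one_eq_eval_derivative, coeff_zero_eq_eval_zero] at hQ1
  refine mul_left_cancel₀ (two_ne_zero (α := K)) ?_
  rw [zsmul_eq_mul] at hQ1
  push_cast at hQ1
  rw [← hQ1]
  simp [derivative_pow]

/-- The difference of the two sides, as a function of `x`, is the trace of a multiadditive map
solving the equation for `κ = 1` and vanishing at 1. -/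
theorem linearDeriv_self_mul (hn : 1 ≤ n) (A : MultilinearMap ℤ (fun _ : Fin n => F) K)
    (h : ∀ x : F, A (fun _ => x ^ 2) = 2 * algebraMap F K x ^ n * A (fun _ => x)) (x z : F) :
    A.linearDeriv (fun _ => x) (fun _ => x * z) =
      algebraMap F K x ^ n * A.linearDeriv (fun _ => 1) (fun _ => z)
        + n * algebraMap F K z * A (fun _ => x) := by
  have hA1 : A (fun _ => 1) = 0 := by
    have := h 1
    simp only [one_pow, map_one, mul_one] at this
    linear_combination -this
  let M : MultilinearMap ℤ (fun _ : Fin n => F) K :=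
    ∑ i, A.compLinearMap (Function.update (fun _ => LinearMap.id) i (LinearMap.mulRight ℤ z))
      - A.linearDeriv (fun _ => 1) (fun _ => z) • algebraMapProd F K n
      - (n * algebraMap F K z) • A
  have hM : ∀ y : F, M (fun _ => y) = A.linearDeriv (fun _ => y) (fun _ => y * z)
      - A.linearDeriv (fun _ => 1) (fun _ => z) * algebraMap F K y ^ n
      - n * algebraMap F K z * A (fun _ => y) := by
    intro y
    simp only [M, sub_apply, smul_apply, algebraMapProd_const, smul_eq_mul,
      sum_apply, MultilinearMap.compLinearMap_apply,
      MultilinearMap.linearDeriv_apply]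
    congr 2
    refine Finset.sum_congr rfl fun i _ => ?_
    congr 1
    ext j
    by_cases hj : j = i
    · subst hj
      simp
    · simp [hj]
  have := trace_eq_zero_of_map_one M (fun y => ?_) ?_ x
  · rw [hM] at this
    linear_combination this
  -- Direction `y * z` in the differentiated equation yields `M(y²) = y ^ n M(y)`.
  · have h1 := linearDeriv_sq_mul A h y (y * z)
    rw [hM, hM, h, show y ^ 2 * z = y * (y * z) by ring, h1, map_mul, map_pow]
    obtain ⟨m, rfl⟩ : ∃ m, n = m + 1 := ⟨n - 1, by omega⟩
    rw [Nat.add_sub_cancel]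
    ring
  · simp [hM, hA1]

end PowerFunctional

/-! ### Higher-order derivations through iterated differences -/

section Derivation

variable {F K : Type*} [Field F] [Field K] [Algebra F K]

theorem IsDerivationOfOrder.succ {m : ℕ} {f : F → K} (h : IsDerivationOfOrder m f) :
    IsDerivationOfOrder (m + 1) f := by
  induction m generalizing f with
  | zero =>
    have h : ∀ x, f x = 0 := h
    refine ⟨fun x y => by simp [h], fun _ _ => 0, fun _ _ => rfl, fun _ _ => rfl, fun x y => ?_⟩
    simp [h]
  | succ m ih =>
    obtain ⟨hadd, B, h1, h2, h3⟩ := h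
    exact ⟨hadd, B, fun y => ih (h1 y), fun x => ih (h2 x), h3⟩

theorem IsDerivationOfOrder.mono {m k : ℕ} (hmk : m ≤ k) {f : F → K}
    (h : IsDerivationOfOrder m f) : IsDerivationOfOrder k f := by
  induction k, hmk using Nat.le_induction with
  | base => exact h
  | succ k _ ih => exact ih.succ

/-- The commutator-type operator `g ↦ (z ↦ g (x z) - x g z)` on additive maps. -/
noncomputable def mulDifference (K : Type*) {F : Type*} [Field F] [Field K] [Algebra F K] (x : F) :
    Module.End K (F →ₗ[ℤ] K) :=
  LinearMap.lcomp K K (LinearMap.mulLeft ℤ x) - algebraMap F K x • 1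

theorem mulDifference_apply (x : F) (g : F →ₗ[ℤ] K) (z : F) :
    mulDifference K x g z = g (x * z) - algebraMap F K x * g z := rfl

theorem mulDifference_add_intCast_mul (x y : F) (t : ℤ) :
    mulDifference K (x + t * y) = mulDifference K x + (t : K) • mulDifference K y := by
  ext g z
  have h1 : g ((x + t * y) * z) = g (x * z) + t * g (y * z) := by
    rw [show (x + t * y) * z = x * z + t • (y * z) by rw [zsmul_eq_mul]; ring,
      map_add, map_zsmul, zsmul_eq_mul]
  simp only [mulDifference_apply, h1, LinearMap.add_apply, LinearMap.smul_apply, map_add, map_mul,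
    map_intCast, smul_eq_mul]
  ring

theorem mulDifference_commute (x y : F) :
    Commute (mulDifference K x) (mulDifference K y) := by
  ext g z
  simp only [Module.End.mul_apply, mulDifference_apply, mul_left_comm x y z]
  ring

theorem mulDifference_pow_apply (x : F) (m : ℕ) (g : F →ₗ[ℤ] K) (z : F) :
    (mulDifference K x ^ m) g z = ∑ j ∈ Finset.range (m + 1),
      m.choose j * (-algebraMap F K x) ^ (m - j) * g (x ^ j * z) := by
  let L : Module.End K (F →ₗ[ℤ] K) := LinearMap.lcomp K K (LinearMap.mulLeft ℤ x)
  have hL : ∀ (j : ℕ) (g : F →ₗ[ℤ] K), (L ^ j) g z = g (x ^ j * z) := by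
    intro j
    induction j with
    | zero => simp
    | succ j ih =>
      intro g
      rw [pow_succ, Module.End.mul_apply, ih, pow_succ', mul_assoc]
      rfl
  have e : mulDifference K x = L + (-algebraMap F K x) • (1 : Module.End K (F →ₗ[ℤ] K)) := by
    ext g z
    simp [mulDifference_apply, L, sub_eq_add_neg, Algebra.smul_def]
  rw [e, ((Commute.one_right L).smul_right _).add_pow, LinearMap.sum_apply, LinearMap.sum_apply]
  refine Finset.sum_congr rfl fun j _ => ?_
  rw [_root_.smul_pow, one_pow, ← (Nat.cast_commute _ _).eq]
  simp [Module.End.mul_apply, hL]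
  ring

/-- Replacing `x` by `x + t y` and expanding the commuting operators, the coefficient of `t` is `m +
1` times the claimed expression. -/
theorem mulDifference_pow_comp_eq_zero [CharZero K] {m : ℕ} {g : F →ₗ[ℤ] K}
    (h : ∀ x : F, (mulDifference K x ^ (m + 1)) g = 0) (x y : F) :
    (mulDifference K x ^ m) (mulDifference K y g) = 0 := by
  ext z
  let p : K[X] := ∑ i ∈ Finset.range (m + 2), monomial (m + 1 - i)
    ((m + 1).choose i * (mulDifference K x ^ i) ((mulDifference K y ^ (m + 1 - i)) g) z)
  have hp : p = 0 := by
    refine eq_of_forall_eval_intCast fun t => ?_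
    have h1 := h (x + t * y)
    rw [mulDifference_add_intCast_mul, ((mulDifference_commute x y).smul_right _).add_pow] at h1
    have h2 := congrArg (fun f => f z) h1
    rw [eval_zero, eval_finsetSum, ← LinearMap.zero_apply (σ₁₂ := RingHom.id ℤ) z, ← h2]
    simp only [LinearMap.sum_apply]
    refine Finset.sum_congr rfl fun i _ => ?_
    rw [eval_monomial, _root_.smul_pow, ← (Nat.cast_commute _ _).eq]
    simp [Module.End.mul_apply]
    ring
  have h1 : p.coeff 1 = 0 := by rw [hp, coeff_zero]
  rw [finsetSum_coeff, Finset.sum_eq_single m] at h1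
  · rw [coeff_monomial, if_pos (by omega), show m + 1 - m = 1 by omega, pow_one] at h1
    refine (mul_eq_zero.mp h1).resolve_left ?_
    rw [Nat.choose_succ_self_right]
    exact Nat.cast_ne_zero.mpr (by omega)
  · intro i hi him
    have := Finset.mem_range.mp hi
    rw [coeff_monomial, if_neg (by omega)]
  · intro hm
    exact absurd (Finset.mem_range.mpr (by omega)) hm

/-- Induction on `m`: the Leibniz defect of `g` with `y` fixed is `mulDifference K y g - g y • ι`.
The correction makes it vanish at 1 and is killed by every `mulDifference`. -/
theorem isDerivationOfOrder_of_mulDifference_pow [CharZero K] {m : ℕ} {g : F →ₗ[ℤ] K}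
    (h : ∀ x : F, (mulDifference K x ^ (m + 1)) g = 0) (h1 : g 1 = 0) :
    IsDerivationOfOrder m g := by
  induction m generalizing g with
  | zero =>
    intro x
    have := congrArg (fun f => f 1) (h x)
    simpa [mulDifference_apply, h1] using this
  | succ m ih =>
    let ι : F →ₗ[ℤ] K := (algebraMap F K).toIntAlgHom.toLinearMap
    have hι : ∀ x, mulDifference K x ι = 0 := by
      intro x
      ext z
      simp [mulDifference_apply, ι]
    have key : ∀ y, IsDerivationOfOrder m ⇑(mulDifference K y g - g y • ι) := by
      intro y
      refine ih (fun x => ?_) ?_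
      · rw [map_sub, mulDifference_pow_comp_eq_zero h, map_smul, pow_succ, Module.End.mul_apply,
          hι]
        simp
      · simp [mulDifference_apply, h1, ι]
    refine ⟨fun x y => map_add g x y, fun x y => g (x * y) - algebraMap F K x * g y -
      g x * algebraMap F K y, fun y => ?_, fun x => ?_, fun x y => rfl⟩
    · have e : (fun x => g (x * y) - algebraMap F K x * g y - g x * algebraMap F K y) =
          ⇑(mulDifference K y g - g y • ι) := by
        ext x
        simp only [LinearMap.sub_apply, LinearMap.smul_apply, mulDifference_apply, ι, smul_eq_mul]
        rw [mul_comm x y]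
        simp
        ring
      rw [e]
      exact key y
    · exact key x

end Derivation

/-! ### Recovering `f` from `a` when `κ = 2` -/

/-- The constants expressing the coefficients of `t ↦ f (1 + t x)` through the values `a (x ^ j)`. -/
noncomputable def derivationCoeff (K : Type*) [Field K] (n : ℕ) : ℕ → ℕ → K
  | 0, _ => 0
  | k + 1, j => ((n - k) * (if j ≤ k then derivationCoeff K n k j else 0) +
      if j = 0 then 0 else (-1 : K) ^ (j - 1) * (n + 1).choose (k + 1 - j)) / (k + 1)

section

variable {F K : Type*} [Field F] [Field K] [Algebra F K] {n : ℕ}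

/-- The hypothesis expresses coefficient `k + 1` at `z` through coefficient `k` at `x * z`;
iterating gives the alternating sum. -/
theorem coeff_eq_sum_of_add_X_mul (a : F → K) (x : F) (m : ℕ) (P : F → K[X])
    (hP : ∀ z, P z + X * P (x * z) = (1 + C (algebraMap F K x) * X) ^ m * C (a z)) (k : ℕ) (z : F) :
    (P z).coeff k = ∑ j ∈ Finset.range (k + 1),
      (-1) ^ j * m.choose (k - j) * algebraMap F K x ^ (k - j) * a (x ^ j * z) := by
  induction k generalizing z with
  | zero =>
    have h := congrArg (fun p => p.coeff 0) (hP z)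
    simp only [coeff_add, coeff_mul_C, coeff_one_add_C_mul_X_pow, coeff_X_mul_zero] at h
    simpa using h
  | succ k ih =>
    have h := congrArg (fun p => p.coeff (k + 1)) (hP z)
    simp only [coeff_add, coeff_mul_C, coeff_one_add_C_mul_X_pow, coeff_X_mul, ih] at h
    rw [Finset.sum_range_succ', eq_sub_of_add_eq h, sub_eq_add_neg, add_comm, ← Finset.sum_neg_distrib]
    congr 1
    · refine Finset.sum_congr rfl fun j _ => ?_
      rw [Nat.add_sub_add_right, pow_succ x, mul_assoc (x ^ j)]
      ring
    · simp

/-- Comparing coefficients in `hTP` gives `(k + 1) T_{k+1} = (n - k) x T_k + P_k`, the recursion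
that defines `derivationCoeff`. -/
theorem coeff_eq_sum_derivationCoeff [CharZero K] (a : F → K) (x : F) (T P : K[X]) (hT : T.coeff 0 = 0)
    (hTP : (1 + C (algebraMap F K x) * X) * derivative T - C (n * algebraMap F K x) * T = P)
    (hP : ∀ k, P.coeff k = ∑ j ∈ Finset.range (k + 1),
      (-1) ^ j * (n + 1).choose (k - j) * algebraMap F K x ^ (k - j) * a (x ^ (j + 1))) (k : ℕ) :
    T.coeff k = ∑ j ∈ Finset.range (k + 1),
      derivationCoeff K n k j * algebraMap F K x ^ (k - j) * a (x ^ j) := by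
  induction k with
  | zero => simp [hT, derivationCoeff]
  | succ k ih =>
    have hk : (k + 1 : K) ≠ 0 := by exact_mod_cast Nat.succ_ne_zero k
    have h1 : (k + 1) * T.coeff (k + 1) = (n - k) * algebraMap F K x * T.coeff k + P.coeff k := by
      rw [← hTP, coeff_sub, coeff_C_mul, add_mul 1 (C _ * X), one_mul, coeff_add,
        coeff_derivative, mul_assoc (C _) X, coeff_C_mul]
      cases k with
      | zero => simp
      | succ k =>
        rw [coeff_X_mul, coeff_derivative]
        push_cast
        ring
    refine mul_left_cancel₀ hk (h1.trans ?_)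
    rw [ih, hP, Finset.mul_sum, Finset.mul_sum]
    have h2 : ∀ j ∈ Finset.range (k + 2), (k + 1 : K) * (derivationCoeff K n (k + 1) j *
        algebraMap F K x ^ (k + 1 - j) * a (x ^ j)) =
        (n - k) * (if j ≤ k then derivationCoeff K n k j else 0) *
          algebraMap F K x ^ (k + 1 - j) * a (x ^ j) +
        (if j = 0 then 0 else (-1 : K) ^ (j - 1) * (n + 1).choose (k + 1 - j)) *
          algebraMap F K x ^ (k + 1 - j) * a (x ^ j) := by
      intro j _
      rw [derivationCoeff]
      field_simp
    rw [Finset.sum_congr rfl h2, Finset.sum_add_distrib]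
    congr 1
    · rw [Finset.sum_range_succ _ (k + 1)]
      simp only [Nat.not_succ_le_self, if_false, mul_zero, zero_mul, add_zero]
      refine Finset.sum_congr rfl fun j hj => ?_
      have hj' : j ≤ k := Nat.lt_succ_iff.mp (Finset.mem_range.mp hj)
      rw [if_pos hj', Nat.succ_sub hj', pow_succ]
      ring
    · rw [Finset.sum_range_succ' _ (k + 1)]
      simp

/-- The structure of the solutions of `f (x ^ 2) = 2 x ^ n f x`. -/
theorem exists_derivation_of_two [CharZero K] (hn : 1 ≤ n) (A : MultilinearMap ℤ (fun _ : Fin n => F) K)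
    (h : ∀ x : F, A (fun _ => x ^ 2) = 2 * algebraMap F K x ^ n * A (fun _ => x)) :
    ∃ a : F → K, IsDerivationOfOrder n a ∧ ∀ x : F, A (fun _ => x) = ∑ j ∈ Finset.Icc 1 n,
      derivationCoeff K n n j * algebraMap F K x ^ (n - j) * a (x ^ j) := by
  have hA1 : A (fun _ => 1) = 0 := by
    have := h 1
    simp only [one_pow, map_one, mul_one] at this
    linear_combination -this
  let a : F →ₗ[ℤ] K := A.linearDeriv (fun _ => 1) ∘ₗ LinearMap.pi fun _ => LinearMap.id
  have ha : ∀ z, a z = A.linearDeriv (fun _ => 1) (fun _ => z) := fun z => rfl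
  have ha1 : a 1 = 0 := by
    rw [ha, MultilinearMap.linearDeriv_apply]
    simp [hA1]
  let T : F → K[X] := fun x => curvePolynomial A (fun _ => 1) (fun _ => x)
  let D : F → F → K[X] := fun x z => ∑ i, curvePolynomial A (Function.update (fun _ => 1) i z)
    (Function.update (fun _ => x) i 0)
  -- `D x z` represents `t ↦ DA(1 + t x)(z)`. This combination absorbs the terms in `T`, leaving a
  -- relation between `P x z` and `P x (x * z)` only.
  let P : F → F → K[X] := fun x z =>
    (1 + C (algebraMap F K x) * X) * D x z - C (n * algebraMap F K z) * T x
  have hline : ∀ (x : F) (t : ℤ), (fun _ : Fin n => 1 + t * x) =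
      (fun _ => 1) + t • (fun _ => x : Fin n → F) := by
    intro x t
    ext j
    simp
  have hT : ∀ (x : F) (t : ℤ), (T x).eval (t : K) = A (fun _ => 1 + t * x) := by
    intro x t
    rw [hline, ← eval_curvePolynomial]
  have hD : ∀ (x z : F) (t : ℤ), (D x z).eval (t : K) =
      A.linearDeriv (fun _ => 1 + t * x) (fun _ => z) := by
    intro x z t
    rw [MultilinearMap.linearDeriv_apply, eval_finsetSum]
    refine Finset.sum_congr rfl fun i _ => ?_
    rw [eval_curvePolynomial]
    congr 1
    ext j
    by_cases hj : j = i
    · subst hj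
      simp
    · simp [hj]
  have hP : ∀ x z, P x z + X * P x (x * z) =
      (1 + C (algebraMap F K x) * X) ^ (n + 1) * C (a z) := by
    intro x z
    refine eq_of_forall_eval_intCast fun t => ?_
    have h1 := linearDeriv_self_mul hn A h (1 + t * x) z
    have e : (fun _ : Fin n => (1 + t * x) * z) =
        (fun _ => z) + t • (fun _ => x * z : Fin n → F) := by
      ext j
      simp
      ring
    rw [e, map_add, map_smul, zsmul_eq_mul, ← hD, ← hD, ← hT, ← ha] at h1
    simp only [map_add, map_mul, map_one, map_intCast] at h1
    simp only [P, eval_add, eval_sub, eval_mul, eval_X, eval_C, eval_one, eval_pow, map_mul]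
    linear_combination (1 + algebraMap F K x * t) * h1
  -- One slot is frozen at `z`, so the degree is below `n`.
  have hDn : ∀ x z k, n ≤ k → (D x z).coeff k = 0 := by
    intro x z k hk
    rw [finsetSum_coeff]
    refine Finset.sum_eq_zero fun i _ => ?_
    rcases hk.eq_or_lt with rfl | hk
    · have := coeff_curvePolynomial_card A (Function.update (fun _ => 1) i z)
        (Function.update (fun _ => x) i 0)
      rw [Fintype.card_fin] at this
      rw [this, A.map_update_zero]
    · exact coeff_eq_zero_of_natDegree_lt
        ((natDegree_curvePolynomial_le A _ _).trans_lt (by simpa using hk))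
  have hPn : ∀ x z, (P x z).coeff (n + 1) = 0 := by
    intro x z
    have hTn : (T x).coeff (n + 1) = 0 := coeff_eq_zero_of_natDegree_lt
      ((natDegree_curvePolynomial_le A _ _).trans_lt (by simp))
    simp only [P]
    rw [coeff_sub, coeff_C_mul, hTn, add_mul, one_mul, coeff_add, mul_assoc, coeff_C_mul,
      coeff_X_mul, hDn x z n le_rfl, hDn x z (n + 1) (by omega)]
    simp
  have hcoeff := fun x => coeff_eq_sum_of_add_X_mul a x (n + 1) (P x) (hP x)
  refine ⟨a, isDerivationOfOrder_of_mulDifference_pow (fun x => ?_) ha1, fun x => ?_⟩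
  -- Up to the sign `(-1) ^ (n + 1)`, the vanishing coefficient `n + 1` of `P x z` is the binomial
  -- expansion of `mulDifference K x ^ (n + 1)`.
  · ext z
    have h1 := hcoeff x (n + 1) z
    rw [hPn] at h1
    rw [mulDifference_pow_apply, LinearMap.zero_apply,
      ← mul_zero ((-1 : K) ^ (n + 1)), h1, Finset.mul_sum]
    refine Finset.sum_congr rfl fun j hj => ?_
    have hj' : j ≤ n + 1 := Nat.lt_succ_iff.mp (Finset.mem_range.mp hj)
    rw [Nat.choose_symm hj', neg_pow]
    have e : (-1 : K) ^ (n + 1 - j) = (-1) ^ (n + 1) * (-1) ^ j := by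
      rw [← pow_add, show n + 1 + j = n + 1 - j + 2 * j by omega, pow_add, pow_mul]
      simp
    rw [e]
    ring
  · have hderiv : derivative (T x) = D x x := by
      refine eq_of_forall_eval_intCast fun t => ?_
      rw [hD, ← taylor_coeff_one, ← coeff_one_curvePolynomial]
      congr 1
      refine eq_of_forall_eval_intCast fun s => ?_
      rw [taylor_eval, eval_curvePolynomial, ← Int.cast_add, hT]
      congr 1
      ext j
      simp
      ring
    have hT0 : (T x).coeff 0 = 0 := by rw [coeff_zero_curvePolynomial, hA1]
    have h1 := coeff_eq_sum_derivationCoeff (n := n) a x (T x) (P x x) hT0 (by rw [hderiv])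
      (fun k => by simpa only [← pow_succ] using hcoeff x k x) n
    have h2 := coeff_curvePolynomial_card A (fun _ => 1) (fun _ => x)
    rw [Fintype.card_fin] at h2
    -- The term `j = 0` drops out because `a 1 = 0`.
    rw [← h2, h1, Finset.range_eq_Ico, Finset.sum_eq_sum_Ico_succ_bot (by omega), pow_zero, ha1,
      mul_zero, zero_add, zero_add]
    rfl

end

/-! ### Assembly of the four cases -/

theorem theorem1 {F K : Type*} [Field F] [Field K] [CharZero F] [CharZero K] [Algebra F K]
    (n : ℕ) (hn : 1 ≤ n) :
    ∃ c : ℕ → K, ∀ (κ : K) (f : F → K), IsGeneralizedMonomial n f →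
      (∀ x : F, f (x ^ 2) = κ * algebraMap F K x ^ n * f x) →
        ((∀ k : ℕ, k ≤ n → κ ≠ 2 ^ k) → ∀ x : F, f x = 0) ∧
        (κ = 1 → ∀ x : F, f x = f 1 * algebraMap F K x ^ n) ∧
        (κ = 2 → ∃ a : F → K, IsDerivationOfOrder (2 * n - 1) a ∧
          ∀ x : F, f x = ∑ j ∈ Finset.Icc 1 n, c j * algebraMap F K x ^ (n - j) * a (x ^ j)) ∧
        (κ = 2 ^ n → ∃ A : MultilinearMap ℤ (fun _ : Fin n => F) K,
          IsSymmetricMultiadditive A ∧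
          (∀ x : Fin (n + 1) → F,
            ∑ σ : Equiv.Perm (Fin (n + 1)), leibnizDefect A (fun i => x (σ i)) = 0) ∧
          ∀ x : F, f x = A (fun _ => x)) := by
  refine ⟨derivationCoeff K n n, ?_⟩
  rintro κ f ⟨A, hA, hf⟩ h
  simp only [hf] at h ⊢
  refine ⟨trace_eq_zero_of_ne_two_pow A κ h, ?_, ?_, ?_⟩
  · rintro rfl
    exact trace_eq_mul_pow A (by simpa using h)
  · rintro rfl
    obtain ⟨a, ha, hfa⟩ := exists_derivation_of_two hn A h
    exact ⟨a, ha.mono (by omega), hfa⟩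
  · rintro rfl
    obtain ⟨m, rfl⟩ : ∃ m, n = m + 1 := ⟨n - 1, by omega⟩
    exact ⟨A, hA, sum_perm_leibnizDefect_eq_zero A (map_update_sq_eq_of_two_pow hA h 0),
      fun _ => rfl⟩
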